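/- Let $d\in\{1,2\}$, let $\|\cdot\|$ be a norm on $\mathbb R^d$, and let $(c_{\{x,y\}})_{x,y\in\mathbb Z^d}$ be an electric network on $\mathbb Z^d$, that is, a family of nonnegative real conductances, one for each unordered pair (self-loops are allowed), such that $\pi(x)=\sum_{y\in\mathbb Z^d}c_{\{x,y\}}<\infty$ for every $x\in\mathbb Z^d$. No translation invariance is assumed. The random walk on the network is the Markov chain on $\mathbb Z^d$ that jumps from $x$ to $y$ with probability $c_{\{x,y\}}/\pi(x)$ (and stays at $x$ if $\pi(x)=0$). The network is called recurrent if, from every starting point, the walk almost surely returns to its starting point, and transient if, from every starting point, with positive probability it never returns to its starting point. 1. If there is a constant $C<\infty$ with $c_{\{x,y\}}\le C\|x-y\|^{-2d}$ for all $x\ne y$, then the network is recurrent. 2. If there are $c>0$ and a real number $s<2d$ with $c_{\{x,y\}}\ge c\|x-y\|^{-s}$ for all $x\neq y$, then the network is transient. -/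

import Mathlib

open MeasureTheory ProbabilityTheory
open scoped NNReal ENNReal

/-- An electric network on the vertex set `V`: every unordered pair of vertices carries a
nonnegative conductance (self-loops are allowed), and the total conductance at every vertex is
finite. No translation invariance or connectedness is required. -/
structure ElectricNetwork (V : Type*) where
  /-- `cond x y` is the conductance of the edge between `x` and `y`. -/
  cond : V → V → ℝ≥0
  symm : ∀ x y, cond x y = cond y x
  summable : ∀ x, Summable (cond x)

namespace ElectricNetwork

variable {V : Type*}

/-- The total conductance is finite, as an extended nonnegative number. -/
theorem tsum_cond_ne_top (G : ElectricNetwork V) (x : V) :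
    ∑' y, (G.cond x y : ℝ≥0∞) ≠ ∞ :=
  ENNReal.tsum_coe_ne_top_iff_summable.2 (G.summable x)

open Classical in
/-- The distribution of one step of the random walk on the network from the vertex `x`: the walk
goes to `y` with probability `cond x y / ∑ z, cond x z`, and it stays at `x` if the total
conductance at `x` is zero. -/
noncomputable def step (G : ElectricNetwork V) (x : V) : PMF V :=
  if h : ∑' y, (G.cond x y : ℝ≥0∞) = 0 then PMF.pure x
  else PMF.normalize (fun y => (G.cond x y : ℝ≥0∞)) h (G.tsum_cond_ne_top x)

section Walk

variable [Countable V] [MeasurableSpace V] [MeasurableSingletonClass V]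

/-- The transition kernel of the random walk on the network. -/
noncomputable def stepKernel (G : ElectricNetwork V) : Kernel V V :=
  Kernel.ofFunOfCountable fun x => (G.step x).toMeasure

instance (G : ElectricNetwork V) : IsMarkovKernel G.stepKernel :=
  ⟨fun x => PMF.toMeasure.isProbabilityMeasure (G.step x)⟩

/-- The law, on the space `ℕ → V` of trajectories, of the random walk on the network started at
`x`: the Markov chain whose next position, given the trajectory `h` up to time `n`, has the
distribution `G.step (h n)`. -/
noncomputable def walk (G : ElectricNetwork V) (x : V) : Measure (ℕ → V) :=
  Kernel.traj (X := fun _ => V)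
    (fun n => G.stepKernel.comap (fun h : (Finset.Iic n → V) => h ⟨n, Finset.mem_Iic.2 le_rfl⟩)
      (measurable_pi_apply _)) 0 (fun _ => x)

/-- The probability that the random walk started at `x` returns to `x`. -/
noncomputable def returnProb (G : ElectricNetwork V) (x : V) : ℝ≥0∞ :=
  G.walk x {X : ℕ → V | ∃ n, 1 ≤ n ∧ X n = x}

/-- The network is recurrent: from every starting point, the random walk almost surely returns
to its starting point. -/
def IsRecurrent (G : ElectricNetwork V) : Prop := ∀ x, G.returnProb x = 1

/-- The network is transient: from every starting point, the random walk has positive probability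
of never returning to its starting point. -/
def IsTransient (G : ElectricNetwork V) : Prop := ∀ x, G.returnProb x < 1

end Walk

end ElectricNetwork

/-- The difference of two points of the integer lattice, as a vector of `ℝ ^ d`. -/
def latticeDiff {d : ℕ} (x y : Fin d → ℤ) : Fin d → ℝ := fun i => ((x i - y i : ℤ) : ℝ)

/-! Both claims reduce to Dirichlet's principle. For a finite `B` containing `x`, the probability of
hitting `x` before leaving `B` is harmonic on `B` off `x`. Its energy equals `total x` times the
probability that the walk from `x` does not return before leaving `B`, and it minimizes the energy
among functions equal to `1` at `x` and set to zero outside `B`. As `B` exhausts the space, return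
is almost sure if test functions of arbitrarily small energy exist (`returnProb_eq_one_of_energy`),
and fails with positive probability if all energies are bounded below
(`returnProb_lt_one_of_energy`). Equivalence of norms replaces the given norm by the supremum norm.

Transience (`isTransient_of_le_cond`): average a finitely supported `f` of energy `E` over cubes of
side `2 ^ k` with corner `x`. Cauchy–Schwarz and the lower bound on conductances make successive
averages differ by at most `√(C * E) * q ^ k`, with `q = 2 ^ ((s - 2 * d) / 2) < 1`. The averages go
from `1` to `0`, so `E` is bounded below.

Recurrence (`isRecurrent_of_cond_le`): the test function is radial, dropping by `δ_j / L` between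
distances `j` and `j + 1` from `x`, where `δ_j = 1 / ((j + 1) * H_{j + 1})` for `j < R` and `L` is
their sum. A weighted Cauchy–Schwarz inequality distributes the energy of a long edge over the
levels it crosses (`sq_truncSum_sub_le`). Level `j` then receives at most a constant times `δ_j ^ 2
* (j + 1) * H_{j + 1} = δ_j` (`sum_sum_cond_mul_sqrt_le`), before division by `L ^ 2`. The energy is
therefore `O(1 / L)`, and `L` diverges at least like `log log R`. -/

namespace ElectricNetwork

/-! ### Hitting probabilities as limits of an iteration of the transition operator. -/

section HittingProbabilities

variable {V : Type*}

/-- The transition operator of the random walk, acting on nonnegative functions. -/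
noncomputable def avg (G : ElectricNetwork V) (g : V → ℝ≥0∞) (y : V) : ℝ≥0∞ :=
  ∑' z, G.step y z * g z

theorem avg_mono (G : ElectricNetwork V) {g h : V → ℝ≥0∞} (hgh : ∀ z, g z ≤ h z) (y : V) :
    G.avg g y ≤ G.avg h y :=
  ENNReal.tsum_le_tsum fun z => mul_le_mul_right (hgh z) _

theorem avg_le_one (G : ElectricNetwork V) {g : V → ℝ≥0∞} (hg : ∀ z, g z ≤ 1) (y : V) :
    G.avg g y ≤ 1 :=
  calc G.avg g y ≤ ∑' z, G.step y z :=
        ENNReal.tsum_le_tsum fun z => mul_le_of_le_one_right' (hg z)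
    _ = 1 := (G.step y).tsum_coe

theorem avg_iSup (G : ElectricNetwork V) {g : ℕ → V → ℝ≥0∞} (hg : Monotone g) (y : V) :
    G.avg (fun z => ⨆ n, g n z) y = ⨆ n, G.avg (g n) y := by
  let _ : MeasurableSpace V := ⊤
  simp only [avg, ← lintegral_count, ENNReal.mul_iSup]
  exact lintegral_iSup (fun n => measurable_from_top)
    fun m n hmn z => mul_le_mul_right (hg hmn z) _

open Classical in
/-- The probability that the walk started at `y` hits `x` within `n` steps and, before that,
does not leave `B`. -/
noncomputable def hitWithin (G : ElectricNetwork V) (x : V) (B : Set V) : ℕ → V → ℝ≥0∞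
  | 0, y => if y = x then 1 else 0
  | n + 1, y => if y = x then 1 else if y ∈ B then G.avg (G.hitWithin x B n) y else 0

theorem hitWithin_self (G : ElectricNetwork V) (x : V) (B : Set V) (n : ℕ) :
    G.hitWithin x B n x = 1 := by
  cases n <;> simp [hitWithin]

theorem hitWithin_succ (G : ElectricNetwork V) {x y : V} {B : Set V} (hyx : y ≠ x) (hy : y ∈ B)
    (n : ℕ) : G.hitWithin x B (n + 1) y = G.avg (G.hitWithin x B n) y := by
  simp [hitWithin, hyx, hy]

theorem hitWithin_of_notMem (G : ElectricNetwork V) {x y : V} {B : Set V} (hyx : y ≠ x)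
    (hy : y ∉ B) (n : ℕ) : G.hitWithin x B n y = 0 := by
  cases n <;> simp [hitWithin, hyx, hy]

theorem hitWithin_le_one (G : ElectricNetwork V) (x : V) (B : Set V) (n : ℕ) (y : V) :
    G.hitWithin x B n y ≤ 1 := by
  induction n generalizing y with
  | zero => rw [hitWithin]; split_ifs <;> simp
  | succ n ih =>
    rw [hitWithin]
    split_ifs
    exacts [le_rfl, G.avg_le_one ih y, zero_le]

theorem hitWithin_mono (G : ElectricNetwork V) (x : V) (B : Set V) :
    Monotone (G.hitWithin x B) := by
  refine monotone_nat_of_le_succ fun n => ?_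
  induction n with
  | zero =>
    intro y
    by_cases hy : y = x
    · subst hy; simp [hitWithin_self]
    · simp [hitWithin, hy]
  | succ n ih =>
    intro y
    by_cases hy : y = x
    · subst hy; simp [hitWithin_self]
    by_cases hB : y ∈ B
    · rw [G.hitWithin_succ hy hB, G.hitWithin_succ hy hB]
      exact G.avg_mono ih y
    · simp [G.hitWithin_of_notMem hy hB]

theorem hitWithin_mono_set (G : ElectricNetwork V) (x : V) {B B' : Set V} (h : B ⊆ B') (n : ℕ) :
    G.hitWithin x B n ≤ G.hitWithin x B' n := by
  induction n with
  | zero => exact le_rfl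
  | succ n ih =>
    intro y
    by_cases hy : y = x
    · subst hy; simp [hitWithin_self]
    by_cases hB : y ∈ B
    · rw [G.hitWithin_succ hy hB, G.hitWithin_succ hy (h hB)]
      exact G.avg_mono ih y
    · simp [G.hitWithin_of_notMem hy hB]

theorem hitWithin_univ_eq_iSup (G : ElectricNetwork V) (x : V) {B : ℕ → Set V} (hB : Monotone B)
    (hcover : ∀ y, ∃ k, y ∈ B k) (n : ℕ) (y : V) :
    G.hitWithin x Set.univ n y = ⨆ k, G.hitWithin x (B k) n y := by
  induction n generalizing y with
  | zero => simp [hitWithin]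
  | succ n ih =>
    by_cases hy : y = x
    · subst hy; simp [hitWithin_self]
    have hmono : Monotone fun k => G.hitWithin x (B k) n :=
      fun k l hkl => G.hitWithin_mono_set x (hB hkl) n
    refine le_antisymm ?_ (iSup_le fun k => G.hitWithin_mono_set x (Set.subset_univ _) _ y)
    rw [G.hitWithin_succ hy (Set.mem_univ y), funext ih, G.avg_iSup hmono]
    obtain ⟨k₀, hk₀⟩ := hcover y
    -- The recursion at `y` is available only once the exhausting set contains `y`, hence the
    -- passage to `max k k₀`.
    refine iSup_le fun k => le_iSup_of_le (max k k₀) ?_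
    rw [G.hitWithin_succ hy (hB (le_max_right k k₀) hk₀)]
    exact G.avg_mono (hmono (le_max_left k k₀)) y

/-- The probability that the walk started at `y` hits `x` before it leaves `B`. -/
noncomputable def hitBefore (G : ElectricNetwork V) (x : V) (B : Set V) (y : V) : ℝ≥0∞ :=
  ⨆ n, G.hitWithin x B n y

theorem hitBefore_self (G : ElectricNetwork V) (x : V) (B : Set V) : G.hitBefore x B x = 1 := by
  simp [hitBefore, hitWithin_self]

theorem hitBefore_of_notMem (G : ElectricNetwork V) {x y : V} {B : Set V} (hyx : y ≠ x)
    (hy : y ∉ B) : G.hitBefore x B y = 0 := by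
  simp [hitBefore, G.hitWithin_of_notMem hyx hy]

theorem hitBefore_le_one (G : ElectricNetwork V) (x : V) (B : Set V) (y : V) :
    G.hitBefore x B y ≤ 1 :=
  iSup_le fun n => G.hitWithin_le_one x B n y

theorem hitBefore_eq_avg (G : ElectricNetwork V) {x y : V} {B : Set V} (hyx : y ≠ x)
    (hy : y ∈ B) : G.hitBefore x B y = G.avg (G.hitBefore x B) y := by
  have h := G.avg_iSup (G.hitWithin_mono x B) y
  rw [show G.hitBefore x B = fun z => ⨆ n, G.hitWithin x B n z from rfl, h]
  simp only [← G.hitWithin_succ hyx hy]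
  exact ((G.hitWithin_mono x B).iSup_nat_add 1 |> fun h => by
    simpa [iSup_apply] using (congrFun h y).symm)

theorem hitBefore_univ_eq_iSup (G : ElectricNetwork V) (x : V) {B : ℕ → Set V} (hB : Monotone B)
    (hcover : ∀ y, ∃ k, y ∈ B k) (y : V) :
    G.hitBefore x Set.univ y = ⨆ k, G.hitBefore x (B k) y := by
  simp only [hitBefore, G.hitWithin_univ_eq_iSup x hB hcover]
  exact iSup_comm

theorem hitBefore_mono_set (G : ElectricNetwork V) (x : V) {B B' : Set V} (h : B ⊆ B') :
    G.hitBefore x B ≤ G.hitBefore x B' :=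
  fun y => iSup_mono fun n => G.hitWithin_mono_set x h n y

end HittingProbabilities

/-! ### Return probability of the trajectory measure in terms of hitting probabilities. -/

section Trajectories

variable {V : Type*} [Countable V] [MeasurableSpace V] [MeasurableSingletonClass V]

instance (G : ElectricNetwork V) (x : V) : IsProbabilityMeasure (G.walk x) := by
  unfold walk; infer_instance

theorem lintegral_stepKernel (G : ElectricNetwork V) (g : V → ℝ≥0∞) (y : V) :
    ∫⁻ z, g z ∂(G.stepKernel y) = G.avg g y := by
  change ∫⁻ z, g z ∂(G.step y).toMeasure = _
  rw [lintegral_countable', avg]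
  simp_rw [PMF.toMeasure_apply_singleton _ _ (measurableSet_singleton _), mul_comm]

/-- The one-step Markov property: conditionally on the path up to time `n`, the next position has
the law of a step from `X n`. -/
theorem lintegral_walk_mul (G : ElectricNetwork V) (x : V) (n : ℕ)
    (φ : (Finset.Iic n → V) → ℝ≥0∞) (g : V → ℝ≥0∞) :
    ∫⁻ X, φ (Preorder.frestrictLe n X) * g (X (n + 1)) ∂(G.walk x) =
      ∫⁻ X, φ (Preorder.frestrictLe n X) * G.avg g (X n) ∂(G.walk x) := by
  have hφ : Measurable φ := measurable_of_countable φ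
  have hg : ∀ f : V → ℝ≥0∞, Measurable f := fun f => measurable_of_countable f
  let κ : (n : ℕ) → Kernel (Finset.Iic n → V) V := fun n =>
    G.stepKernel.comap (fun h : (Finset.Iic n → V) => h ⟨n, Finset.mem_Iic.2 le_rfl⟩)
      (measurable_pi_apply _)
  have key := Kernel.partialTraj_compProd_eq_map_traj (X := fun _ => V) (κ := κ) (Nat.zero_le n)
    (x₀ := fun _ => x)
  have hw : G.walk x = Kernel.traj (X := fun _ => V) κ 0 (fun _ => x) := rfl
  have hpt := Kernel.traj_map_frestrictLe_apply (X := fun _ => V) (κ := κ) 0 n (fun _ => x)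
  calc ∫⁻ X, φ (Preorder.frestrictLe n X) * g (X (n + 1)) ∂(G.walk x)
      = ∫⁻ p, φ p.1 * g p.2 ∂((G.walk x).map fun X => (Preorder.frestrictLe n X, X (n + 1))) := by
        rw [lintegral_map (by fun_prop) (by fun_prop)]
    _ = ∫⁻ h, φ h * G.avg g (h ⟨n, Finset.mem_Iic.2 le_rfl⟩)
          ∂(Kernel.partialTraj (X := fun _ => V) κ 0 n (fun _ => x)) := by
        rw [hw, ← key, Measure.lintegral_compProd (by fun_prop)]
        refine lintegral_congr fun h => ?_
        exact (lintegral_const_mul _ (hg g)).trans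
          (congrArg (φ h * ·) (G.lintegral_stepKernel g _))
    _ = _ := by
        rw [← hpt, ← hw, lintegral_map (measurable_of_countable _) (by fun_prop)]
        rfl

theorem walk_zero_ae (G : ElectricNetwork V) (x : V) : ∀ᵐ X ∂(G.walk x), X 0 = x := by
  let κ : (n : ℕ) → Kernel (Finset.Iic n → V) V := fun n =>
    G.stepKernel.comap (fun h : (Finset.Iic n → V) => h ⟨n, Finset.mem_Iic.2 le_rfl⟩)
      (measurable_pi_apply _)
  have hpt := Kernel.traj_map_frestrictLe_apply (X := fun _ => V) (κ := κ) 0 0 (fun _ => x)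
  have hw : G.walk x = Kernel.traj (X := fun _ => V) κ 0 (fun _ => x) := rfl
  rw [← hw, Kernel.partialTraj_self, Kernel.id_apply] at hpt
  have h : ∀ᵐ h ∂((G.walk x).map (Preorder.frestrictLe (π := fun _ => V) 0)),
      h ⟨0, Finset.mem_Iic.2 le_rfl⟩ = x := by
    rw [hpt, ae_dirac_iff]
    exact measurableSet_eq_fun (measurable_pi_apply _) measurable_const
  exact ae_of_ae_map (by fun_prop) h

open Classical in
-- Induction on `m` trades one step of the hitting recursion for one step of the path by the Markov
-- property; the total horizon `n + 1 + m` stays fixed.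
theorem walk_return_le (G : ElectricNetwork V) (x : V) (m n : ℕ) :
    ∫⁻ X, ((if ∃ i, 1 ≤ i ∧ i ≤ n + 1 ∧ X i = x then 1 else 0) +
        (if ∃ i, 1 ≤ i ∧ i ≤ n + 1 ∧ X i = x then 0 else 1) *
          G.hitWithin x Set.univ m (X (n + 1))) ∂(G.walk x) =
      G.walk x {X | ∃ i, 1 ≤ i ∧ i ≤ n + 1 + m ∧ X i = x} := by
  have hmeas : ∀ k, MeasurableSet {X : ℕ → V | ∃ i, 1 ≤ i ∧ i ≤ k ∧ X i = x} := fun k => by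
    have : {X : ℕ → V | ∃ i, 1 ≤ i ∧ i ≤ k ∧ X i = x} =
        ⋃ i ∈ {i | 1 ≤ i ∧ i ≤ k}, (fun X : ℕ → V => X i) ⁻¹' {x} := by
      ext X; simp [and_assoc]
    rw [this]
    exact MeasurableSet.biUnion (Set.to_countable _)
      fun i _ => measurable_pi_apply i (measurableSet_singleton x)
  induction m generalizing n with
  | zero =>
    rw [← lintegral_indicator_one (hmeas _)]
    refine lintegral_congr fun X => ?_
    by_cases h : ∃ i, 1 ≤ i ∧ i ≤ n + 1 ∧ X i = x
    · simp [Set.indicator, h]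
    · have hx : X (n + 1) ≠ x := fun hx => h ⟨n + 1, by omega, le_rfl, hx⟩
      simp [Set.indicator, h, hitWithin, hx]
  | succ m ih =>
    have h1 : Measurable fun X : ℕ → V =>
        (if ∃ i, 1 ≤ i ∧ i ≤ n + 1 ∧ X i = x then 1 else 0 : ℝ≥0∞) :=
      Measurable.ite (hmeas _) measurable_const measurable_const
    rw [show n + 1 + (m + 1) = n + 1 + 1 + m by ring, ← ih (n + 1), lintegral_add_left h1]
    have key := G.lintegral_walk_mul x (n + 1)
      (fun h => if ∃ i : Finset.Iic (n + 1), 1 ≤ i.1 ∧ h i = x then 0 else 1)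
      (G.hitWithin x Set.univ m)
    have hiff : ∀ X : ℕ → V, (∃ i : Finset.Iic (n + 1), 1 ≤ i.1 ∧
        Preorder.frestrictLe (π := fun _ => V) (n + 1) X i = x) ↔
        ∃ i, 1 ≤ i ∧ i ≤ n + 1 ∧ X i = x := fun X => by
      simp only [Subtype.exists, Finset.mem_Iic, Preorder.frestrictLe_apply]
      exact exists_congr fun i => by tauto
    simp only [hiff] at key
    have h2 : ∫⁻ X, (if ∃ i, 1 ≤ i ∧ i ≤ n + 1 ∧ X i = x then 0 else 1) *
          G.hitWithin x Set.univ (m + 1) (X (n + 1)) ∂(G.walk x) =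
        ∫⁻ X, (if ∃ i, 1 ≤ i ∧ i ≤ n + 1 ∧ X i = x then 0 else 1) *
          G.avg (G.hitWithin x Set.univ m) (X (n + 1)) ∂(G.walk x) := by
      refine lintegral_congr fun X => ?_
      by_cases h : ∃ i, 1 ≤ i ∧ i ≤ n + 1 ∧ X i = x
      · simp [h]
      · have hx : X (n + 1) ≠ x := fun hx => h ⟨n + 1, by omega, le_rfl, hx⟩
        rw [G.hitWithin_succ hx (Set.mem_univ _)]
    rw [h2, ← key, ← lintegral_add_left h1]
    refine lintegral_congr fun X => ?_
    by_cases h : ∃ i, 1 ≤ i ∧ i ≤ n + 1 ∧ X i = x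
    · have h' : ∃ i, 1 ≤ i ∧ i ≤ n + 1 + 1 ∧ X i = x := by
        obtain ⟨i, h1, h2, h3⟩ := h
        exact ⟨i, h1, by omega, h3⟩
      simp only [h, h', if_true, zero_mul]
    · by_cases hx : X (n + 1 + 1) = x
      · have h' : ∃ i, 1 ≤ i ∧ i ≤ n + 1 + 1 ∧ X i = x := ⟨n + 1 + 1, by omega, le_rfl, hx⟩
        simp only [h, h', if_true, if_false, hx, hitWithin_self, zero_mul, one_mul, zero_add,
          add_zero]
      · have h' : ¬ ∃ i, 1 ≤ i ∧ i ≤ n + 1 + 1 ∧ X i = x := by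
          rintro ⟨i, h1, h2, h3⟩
          rcases Nat.lt_or_ge i (n + 1 + 1) with h4 | h4
          · exact h ⟨i, h1, by omega, h3⟩
          · exact hx (by rwa [le_antisymm h2 h4] at h3)
        simp only [h, h', if_false]

theorem walk_return_le_eq_avg (G : ElectricNetwork V) (x : V) (m : ℕ) :
    G.walk x {X | ∃ i, 1 ≤ i ∧ i ≤ 1 + m ∧ X i = x} = G.avg (G.hitWithin x Set.univ m) x := by
  classical
  have h := G.walk_return_le x m 0
  rw [zero_add] at h
  rw [← h]
  have h1 := G.lintegral_walk_mul x 0 (fun _ => 1) (G.hitWithin x Set.univ m)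
  calc _ = ∫⁻ X, 1 * G.hitWithin x Set.univ m (X (0 + 1)) ∂(G.walk x) := by
        refine lintegral_congr fun X => ?_
        have : (∃ i, 1 ≤ i ∧ i ≤ 1 ∧ X i = x) ↔ X 1 = x :=
          ⟨fun ⟨i, h1, h2, h3⟩ => le_antisymm h2 h1 ▸ h3, fun h => ⟨1, le_rfl, le_rfl, h⟩⟩
        by_cases hx : X 1 = x
        · simp [this, hx, hitWithin_self]
        · simp [this, hx]
    _ = ∫⁻ X, 1 * G.avg (G.hitWithin x Set.univ m) (X 0) ∂(G.walk x) := h1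
    _ = ∫⁻ _, G.avg (G.hitWithin x Set.univ m) x ∂(G.walk x) := by
        refine lintegral_congr_ae ?_
        filter_upwards [G.walk_zero_ae x] with X hX
        rw [hX, one_mul]
    _ = _ := by simp

theorem returnProb_eq_avg (G : ElectricNetwork V) (x : V) :
    G.returnProb x = G.avg (G.hitBefore x Set.univ) x := by
  have h : {X : ℕ → V | ∃ n, 1 ≤ n ∧ X n = x} =
      ⋃ m, {X | ∃ i, 1 ≤ i ∧ i ≤ 1 + m ∧ X i = x} := by
    ext X
    simp only [Set.mem_ofPred_eq, Set.mem_iUnion]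
    exact ⟨fun ⟨n, h1, h2⟩ => ⟨n, n, h1, by omega, h2⟩, fun ⟨_, n, h1, _, h2⟩ => ⟨n, h1, h2⟩⟩
  have hmono : Monotone fun m => {X : ℕ → V | ∃ i, 1 ≤ i ∧ i ≤ 1 + m ∧ X i = x} :=
    fun m m' hm X ⟨i, h1, h2, h3⟩ => ⟨i, h1, h2.trans (by omega), h3⟩
  rw [returnProb, h, hmono.measure_iUnion]
  simp only [walk_return_le_eq_avg]
  exact (G.avg_iSup (G.hitWithin_mono x Set.univ) x).symm

end Trajectories

end ElectricNetwork

namespace ElectricNetwork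

/-! ### Dirichlet energy and its link with the return probability. -/

section Energy

variable {V : Type*}

/-- The total conductance at a vertex. -/
noncomputable def total (G : ElectricNetwork V) (x : V) : ℝ := ∑' y, (G.cond x y : ℝ)

theorem summable_coe (G : ElectricNetwork V) (x : V) : Summable fun y => (G.cond x y : ℝ) :=
  NNReal.summable_coe.2 (G.summable x)

theorem sum_cond_le_total (G : ElectricNetwork V) (x : V) (B : Finset V) :
    ∑ y ∈ B, (G.cond x y : ℝ) ≤ G.total x :=
  (G.summable_coe x).sum_le_tsum B fun _ _ => NNReal.coe_nonneg _

theorem total_nonneg (G : ElectricNetwork V) (x : V) : 0 ≤ G.total x :=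
  tsum_nonneg fun _ => NNReal.coe_nonneg _

theorem toReal_tsum_cond (G : ElectricNetwork V) (x : V) :
    (∑' y, (G.cond x y : ℝ≥0∞)).toReal = G.total x := by
  rw [ENNReal.tsum_toReal_eq fun _ => ENNReal.coe_ne_top]
  rfl

theorem tsum_cond_eq_zero_iff (G : ElectricNetwork V) (x : V) :
    ∑' y, (G.cond x y : ℝ≥0∞) = 0 ↔ G.total x = 0 := by
  rw [← toReal_tsum_cond, ENNReal.toReal_eq_zero_iff]
  simp [G.tsum_cond_ne_top x]

theorem total_mul_step (G : ElectricNetwork V) {x : V} (hx : G.total x ≠ 0) (y : V) :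
    G.total x * (G.step x y).toReal = G.cond x y := by
  rw [step, dif_neg (mt (G.tsum_cond_eq_zero_iff x).1 hx), PMF.normalize_apply,
    ENNReal.toReal_mul, ENNReal.toReal_inv, toReal_tsum_cond, ENNReal.coe_toReal]
  field_simp

theorem total_mul_avg (G : ElectricNetwork V) {B : Finset V} {g : V → ℝ≥0∞}
    (hg : ∀ z, g z ≤ 1) (hB : ∀ z ∉ B, g z = 0) (y : V) :
    G.total y * (G.avg g y).toReal = ∑ z ∈ B, (G.cond y z : ℝ) * (g z).toReal := by
  by_cases hy : G.total y = 0
  · have h0 : ∀ z, (G.cond y z : ℝ) = 0 := fun z =>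
      le_antisymm (by simpa [hy] using G.sum_cond_le_total y {z}) (NNReal.coe_nonneg _)
    simp [hy, h0]
  · have hne : ∀ z, G.step y z * g z ≠ ∞ := fun z =>
      ENNReal.mul_ne_top ((G.step y).apply_ne_top z) ((hg z).trans_lt ENNReal.one_lt_top).ne
    rw [avg, tsum_eq_sum (s := B) fun z hz => by simp [hB z hz],
      ENNReal.toReal_sum fun z _ => hne z, Finset.mul_sum]
    refine Finset.sum_congr rfl fun z _ => ?_
    rw [ENNReal.toReal_mul, ← mul_assoc, G.total_mul_step hy]

/-- The Dirichlet energy of a function that vanishes outside the finite set `B`. -/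
noncomputable def energy (G : ElectricNetwork V) (B : Finset V) (f : V → ℝ) : ℝ :=
  ∑ y ∈ B, f y * (G.total y * f y - ∑ z ∈ B, G.cond y z * f z)

/-- The second sum is the energy of the edges leaving `B`, across which `f` drops to zero. -/
theorem energy_eq (G : ElectricNetwork V) (B : Finset V) (f : V → ℝ) :
    G.energy B f = (∑ y ∈ B, ∑ z ∈ B, (G.cond y z : ℝ) * (f y - f z) ^ 2) / 2 +
      ∑ y ∈ B, (G.total y - ∑ z ∈ B, (G.cond y z : ℝ)) * f y ^ 2 := by
  have h1 : ∑ y ∈ B, ∑ z ∈ B, (G.cond y z : ℝ) * f z ^ 2 =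
      ∑ y ∈ B, ∑ z ∈ B, (G.cond y z : ℝ) * f y ^ 2 := by
    rw [Finset.sum_comm]
    simp_rw [G.symm]
  have h2 : ∑ y ∈ B, ∑ z ∈ B, (G.cond y z : ℝ) * (f y - f z) ^ 2 =
      ∑ y ∈ B, ∑ z ∈ B, (G.cond y z : ℝ) * f y ^ 2 +
      ∑ y ∈ B, ∑ z ∈ B, (G.cond y z : ℝ) * f z ^ 2 -
      2 * ∑ y ∈ B, ∑ z ∈ B, f y * (G.cond y z * f z) := by
    simp only [Finset.mul_sum, ← Finset.sum_add_distrib, ← Finset.sum_sub_distrib]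
    exact Finset.sum_congr rfl fun y _ => Finset.sum_congr rfl fun z _ => by ring
  rw [h2, h1]
  simp only [energy, mul_sub, sub_mul, Finset.sum_sub_distrib, Finset.sum_mul, Finset.mul_sum]
  have h3 : ∑ y ∈ B, f y * (G.total y * f y) = ∑ y ∈ B, G.total y * f y ^ 2 :=
    Finset.sum_congr rfl fun y _ => by ring
  rw [h3]
  simp only [← Finset.mul_sum]
  ring

theorem energy_ge (G : ElectricNetwork V) (B : Finset V) (f : V → ℝ) :
    (∑ y ∈ B, ∑ z ∈ B, (G.cond y z : ℝ) * (f y - f z) ^ 2) / 2 ≤ G.energy B f := by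
  rw [energy_eq]
  exact le_add_of_nonneg_right <| Finset.sum_nonneg fun y _ =>
    mul_nonneg (sub_nonneg.2 (G.sum_cond_le_total y B)) (sq_nonneg _)

theorem energy_nonneg (G : ElectricNetwork V) (B : Finset V) (f : V → ℝ) : 0 ≤ G.energy B f :=
  le_trans (by positivity) (G.energy_ge B f)

theorem energy_eq_of_subset (G : ElectricNetwork V) {B B' : Finset V} (h : B ⊆ B') {f : V → ℝ}
    (hf : ∀ y ∉ B, f y = 0) : G.energy B' f = G.energy B f := by
  unfold energy
  rw [← Finset.sum_subset h fun y _ hy => by simp [hf y hy]]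
  refine Finset.sum_congr rfl fun y _ => ?_
  rw [← Finset.sum_subset h fun z _ hz => by simp [hf z hz]]

/-- Enlarging `B'` leaves the energy unchanged, while the conductance leaving `B'` from the points
of `B` tends to zero. -/
theorem energy_le_of_forall (G : ElectricNetwork V) {B : Finset V} {f : V → ℝ} {D : ℝ}
    (hf : ∀ y ∉ B, f y = 0)
    (hD : ∀ B', B ⊆ B' → ∑ y ∈ B', ∑ z ∈ B', (G.cond y z : ℝ) * (f y - f z) ^ 2 ≤ 2 * D) :
    G.energy B f ≤ D := by
  classical
  have hlim : Filter.Tendsto (fun B' : Finset V =>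
      D + ∑ y ∈ B, (G.total y - ∑ z ∈ B', (G.cond y z : ℝ)) * f y ^ 2) Filter.atTop
      (nhds (D + ∑ y ∈ B, (G.total y - G.total y) * f y ^ 2)) :=
    tendsto_const_nhds.add <| tendsto_finsetSum _ fun y _ =>
      (tendsto_const_nhds.sub (G.summable_coe y).hasSum).mul tendsto_const_nhds
  have hlim' : D + ∑ y ∈ B, (G.total y - G.total y) * f y ^ 2 = D := by simp
  rw [hlim'] at hlim
  refine ge_of_tendsto hlim ?_
  filter_upwards [Filter.eventually_ge_atTop B] with B' hB'
  rw [← G.energy_eq_of_subset hB' hf, energy_eq]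
  refine add_le_add (by linarith [hD B' hB']) (le_of_eq ?_)
  exact (Finset.sum_subset hB' fun y _ hy => by simp [hf y hy]).symm

/-- Dirichlet's principle: among the functions with value `1` at `x`, the energy is minimal at the
one that is harmonic off `x`. -/
theorem energy_harmonic_le (G : ElectricNetwork V) {B : Finset V} {x : V} {v f : V → ℝ}
    (hv : v x = 1) (hf : f x = 1)
    (hharm : ∀ y ∈ B, y ≠ x → G.total y * v y = ∑ z ∈ B, (G.cond y z : ℝ) * v z) :
    G.energy B v ≤ G.energy B f := by
  -- Orthogonality: `f - v` vanishes at `x`, and `v` is harmonic at every other point of `B`.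
  have hcross : ∑ y ∈ B, (f y - v y) * (G.total y * v y - ∑ z ∈ B, G.cond y z * v z) = 0 := by
    refine Finset.sum_eq_zero fun y hy => ?_
    by_cases hyx : y = x
    · simp [hyx, hf, hv]
    · simp [hharm y hy hyx]
  have hsymm : ∑ y ∈ B, ∑ z ∈ B, v y * (G.cond y z * f z) =
      ∑ y ∈ B, ∑ z ∈ B, f y * (G.cond y z * v z) := by
    rw [Finset.sum_comm]
    refine Finset.sum_congr rfl fun y _ => Finset.sum_congr rfl fun z _ => ?_
    rw [G.symm]; ring
  have hexp : G.energy B f = G.energy B v + G.energy B (fun y => f y - v y) +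
      2 * ∑ y ∈ B, (f y - v y) * (G.total y * v y - ∑ z ∈ B, G.cond y z * v z) := by
    have e1 : ∀ g h : V → ℝ, ∑ y ∈ B, g y * (G.total y * h y - ∑ z ∈ B, G.cond y z * h z) =
        ∑ y ∈ B, G.total y * g y * h y - ∑ y ∈ B, ∑ z ∈ B, g y * (G.cond y z * h z) := by
      intro g h
      simp only [← Finset.mul_sum, ← Finset.sum_sub_distrib]
      exact Finset.sum_congr rfl fun y _ => by ring
    unfold energy
    rw [e1 f f, e1 v v, e1 (fun y => f y - v y) (fun y => f y - v y), e1 (fun y => f y - v y) v]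
    simp only [mul_sub, sub_mul, Finset.sum_sub_distrib]
    rw [hsymm]
    have : ∑ y ∈ B, G.total y * v y * f y = ∑ y ∈ B, G.total y * f y * v y :=
      Finset.sum_congr rfl fun y _ => by ring
    rw [this]
    ring
  rw [hexp, hcross]
  linarith [G.energy_nonneg B fun y => f y - v y]

theorem energy_harmonic_eq (G : ElectricNetwork V) {B : Finset V} {x : V} (hx : x ∈ B) {v : V → ℝ}
    (hv : v x = 1)
    (hharm : ∀ y ∈ B, y ≠ x → G.total y * v y = ∑ z ∈ B, (G.cond y z : ℝ) * v z) :
    G.energy B v = G.total x - ∑ z ∈ B, (G.cond x z : ℝ) * v z := by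
  unfold energy
  rw [Finset.sum_eq_single_of_mem x hx fun y hy hyx => by simp [hharm y hy hyx], hv]
  ring

variable (G : ElectricNetwork V)

theorem hitBefore_of_notMem_finset {x : V} {B : Finset V} (hx : x ∈ B) {y : V}
    (hy : y ∉ B) : G.hitBefore x B y = 0 :=
  G.hitBefore_of_notMem (fun h => hy (h ▸ hx)) (by simpa using hy)

theorem hitBefore_harmonic {x : V} {B : Finset V} (hx : x ∈ B) {y : V} (hy : y ∈ B)
    (hyx : y ≠ x) : G.total y * (G.hitBefore x B y).toReal =
      ∑ z ∈ B, (G.cond y z : ℝ) * (G.hitBefore x B z).toReal := by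
  rw [← G.total_mul_avg (G.hitBefore_le_one x B) (fun z hz => G.hitBefore_of_notMem_finset hx hz),
    ← G.hitBefore_eq_avg hyx (by simpa using hy)]

theorem energy_hitBefore {x : V} {B : Finset V} (hx : x ∈ B) :
    G.energy B (fun y => (G.hitBefore x B y).toReal) =
      G.total x * (1 - (G.avg (G.hitBefore x B) x).toReal) := by
  rw [G.energy_harmonic_eq hx (by simp [hitBefore_self]) fun y hy hyx =>
      G.hitBefore_harmonic hx hy hyx,
    ← G.total_mul_avg (G.hitBefore_le_one x B) (fun z hz => G.hitBefore_of_notMem_finset hx hz)]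
  ring

theorem energy_hitBefore_le {x : V} {B : Finset V} (hx : x ∈ B) {f : V → ℝ} (hf : f x = 1) :
    G.total x * (1 - (G.avg (G.hitBefore x B) x).toReal) ≤ G.energy B f := by
  rw [← G.energy_hitBefore hx]
  exact G.energy_harmonic_le (by simp [hitBefore_self]) hf fun y hy hyx =>
    G.hitBefore_harmonic hx hy hyx

variable [Countable V] [MeasurableSpace V] [MeasurableSingletonClass V]

theorem returnProb_le_one (x : V) : G.returnProb x ≤ 1 := prob_le_one

theorem returnProb_eq_one_of_energy {x : V}
    (h : ∀ ε > 0, ∃ (B : Finset V) (f : V → ℝ), x ∈ B ∧ f x = 1 ∧ G.energy B f ≤ ε) :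
    G.returnProb x = 1 := by
  refine le_antisymm (G.returnProb_le_one x) ?_
  rw [returnProb_eq_avg]
  -- At an isolated vertex the walk stays put and returns at time one.
  by_cases hx : G.total x = 0
  · have hs : G.step x = PMF.pure x := by
      rw [step, dif_pos ((G.tsum_cond_eq_zero_iff x).2 hx)]
    simp [hs, hitBefore_self, avg]
  · have hpos : 0 < G.total x := lt_of_le_of_ne (G.total_nonneg x) (Ne.symm hx)
    have hne : G.avg (G.hitBefore x Set.univ) x ≠ ∞ :=
      ((G.avg_le_one (G.hitBefore_le_one x _) x).trans_lt ENNReal.one_lt_top).ne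
    rw [← ENNReal.ofReal_one, ENNReal.ofReal_le_iff_le_toReal hne]
    refine le_of_forall_pos_sub_le fun ε hε => ?_
    obtain ⟨B, f, hxB, hfx, hE⟩ := h (G.total x * ε) (mul_pos hpos hε)
    have h1 := le_of_mul_le_mul_left ((G.energy_hitBefore_le hxB hfx).trans hE) hpos
    have h2 := ENNReal.toReal_mono hne
      (G.avg_mono (G.hitBefore_mono_set x (Set.subset_univ (B : Set V))) x)
    linarith

theorem returnProb_lt_one_of_energy {x : V} {ε : ℝ} (hε : 0 < ε)
    (h : ∀ (B : Finset V) (f : V → ℝ), x ∈ B → f x = 1 → (∀ y ∉ B, f y = 0) →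
      ε ≤ G.energy B f) :
    G.returnProb x < 1 := by
  classical
  have : Nonempty V := ⟨x⟩
  obtain ⟨e, he⟩ := exists_surjective_nat V
  let B : ℕ → Finset V := fun k => insert x ((Finset.range k).image e)
  have hB : Monotone fun k => (B k : Set V) := fun k l hkl =>
    Finset.coe_subset.2 <| Finset.insert_subset_insert _ <| Finset.image_mono _ <|
      Finset.range_mono hkl
  have hcover : ∀ y, ∃ k, y ∈ (B k : Set V) := fun y => by
    obtain ⟨n, rfl⟩ := he y
    refine ⟨n + 1, ?_⟩
    simp only [B, Finset.coe_insert, Set.mem_insert_iff, Finset.mem_coe, Finset.mem_image]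
    exact Or.inr ⟨n, by simp, rfl⟩
  have hbound : ∀ k, ε ≤ G.total x * (1 - (G.avg (G.hitBefore x (B k)) x).toReal) := fun k => by
    rw [← G.energy_hitBefore (Finset.mem_insert_self x _)]
    exact h _ _ (Finset.mem_insert_self x _) (by simp [hitBefore_self]) fun y hy => by
      rw [G.hitBefore_of_notMem_finset (Finset.mem_insert_self x _) hy, ENNReal.toReal_zero]
  have hpos : 0 < G.total x := by
    refine lt_of_le_of_ne (G.total_nonneg x) fun h0 => ?_
    have := hbound 0
    rw [← h0, zero_mul] at this
    exact this.not_gt hε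
  have hle : ∀ k, G.avg (G.hitBefore x (B k)) x ≤ ENNReal.ofReal (1 - ε / G.total x) := fun k => by
    have hk := hbound k
    rw [mul_comm, ← div_le_iff₀ hpos] at hk
    have h0 := ENNReal.toReal_nonneg (a := G.avg (G.hitBefore x (B k)) x)
    rw [ENNReal.le_ofReal_iff_toReal_le
      ((G.avg_le_one (G.hitBefore_le_one x _) x).trans_lt ENNReal.one_lt_top).ne (by linarith)]
    linarith
  rw [returnProb_eq_avg, funext (G.hitBefore_univ_eq_iSup x hB hcover),
    G.avg_iSup fun k l hkl => G.hitBefore_mono_set x (hB hkl)]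
  refine (iSup_le hle).trans_lt ?_
  rw [← ENNReal.ofReal_one]
  exact (ENNReal.ofReal_lt_ofReal_iff one_pos).2 (by linarith [div_pos hε hpos])

end Energy

end ElectricNetwork

/-! ### The supremum norm on the lattice and equivalence of norms. -/

section LatticeNorm

variable {d : ℕ}

/-- The supremum norm on the integer lattice, as a natural number. -/
def supNorm (z : Fin d → ℤ) : ℕ := Finset.univ.sup fun i => (z i).natAbs

theorem supNorm_le_iff {z : Fin d → ℤ} {n : ℕ} : supNorm z ≤ n ↔ ∀ i, (z i).natAbs ≤ n := by
  simp [supNorm]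

theorem natAbs_le_supNorm (z : Fin d → ℤ) (i : Fin d) : (z i).natAbs ≤ supNorm z :=
  supNorm_le_iff.1 le_rfl i

theorem supNorm_eq_zero_iff {z : Fin d → ℤ} : supNorm z = 0 ↔ z = 0 := by
  rw [← Nat.le_zero, supNorm_le_iff, funext_iff]
  simp

theorem supNorm_sub_pos {x y : Fin d → ℤ} (h : x ≠ y) : 0 < supNorm (x - y) :=
  Nat.pos_of_ne_zero fun h0 => h (sub_eq_zero.1 (supNorm_eq_zero_iff.1 h0))

theorem supNorm_sub_comm (x y : Fin d → ℤ) : supNorm (x - y) = supNorm (y - x) := by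
  unfold supNorm
  congr 1
  funext i
  rw [Pi.sub_apply, Pi.sub_apply]
  omega

theorem supNorm_le_add (x y : Fin d → ℤ) : supNorm y ≤ supNorm x + supNorm (x - y) := by
  refine supNorm_le_iff.2 fun i => ?_
  have h1 := natAbs_le_supNorm x i
  have h2 := natAbs_le_supNorm (x - y) i
  rw [Pi.sub_apply] at h2
  omega

/-- The lattice points of supremum norm at most `n`. -/
noncomputable def latticeBox (d n : ℕ) : Finset (Fin d → ℤ) := Finset.Icc (fun _ => -(n : ℤ)) fun _ => (n : ℤ)

theorem mem_latticeBox {n : ℕ} {z : Fin d → ℤ} : z ∈ latticeBox d n ↔ supNorm z ≤ n := by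
  rw [latticeBox, Finset.mem_Icc, supNorm_le_iff, Pi.le_def, Pi.le_def, ← forall_and]
  exact forall_congr' fun i => by omega

theorem card_latticeBox (d n : ℕ) : (latticeBox d n).card = (2 * n + 1) ^ d := by
  rw [latticeBox, Pi.card_Icc]
  have : ((n : ℤ) + 1 - -n).toNat = 2 * n + 1 := by omega
  simp only [Int.card_Icc, this, Finset.prod_const, Finset.card_univ, Fintype.card_fin]

theorem norm_latticeDiff (x y : Fin d → ℤ) : ‖latticeDiff x y‖ = supNorm (x - y) := by
  refine le_antisymm ((pi_norm_le_iff_of_nonneg (Nat.cast_nonneg _)).2 fun i => ?_) ?_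
  · have := natAbs_le_supNorm (x - y) i
    rw [latticeDiff, Real.norm_eq_abs, ← Int.cast_abs, Int.abs_eq_natAbs]
    exact_mod_cast this
  · rw [← Nat.le_floor_iff (norm_nonneg _), supNorm_le_iff]
    intro i
    rw [Nat.le_floor_iff (norm_nonneg _)]
    refine le_trans (le_of_eq ?_) (norm_le_pi_norm (latticeDiff x y) i)
    rw [latticeDiff, Real.norm_eq_abs, ← Int.cast_abs, Int.abs_eq_natAbs]
    rfl

end LatticeNorm

theorem Seminorm.exists_norm_bounds {ι : Type*} [Fintype ι] (N : Seminorm ℝ (ι → ℝ))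
    (hN : ∀ v, N v = 0 → v = 0) :
    ∃ a b : ℝ, 0 < a ∧ 0 < b ∧ ∀ v, a * ‖v‖ ≤ N v ∧ N v ≤ b * ‖v‖ := by
  classical
  let b : ℝ := 1 + ∑ i, N (Pi.single i 1)
  have hb0 : 0 < b := add_pos_of_pos_of_nonneg one_pos (Finset.sum_nonneg fun _ _ => apply_nonneg _ _)
  have hb : ∀ v, N v ≤ b * ‖v‖ := fun v => by
    calc N v = N (∑ i, v i • (Pi.single i 1 : ι → ℝ)) := by
          congr 1; ext j; simp [Finset.sum_apply, Pi.single_apply]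
      _ ≤ ∑ i, N (v i • (Pi.single i 1 : ι → ℝ)) := Finset.le_sum_of_subadditive N (map_zero N).le (map_add_le_add N) _ _
      _ ≤ ∑ i, N (Pi.single i 1) * ‖v‖ := Finset.sum_le_sum fun i _ => by
          rw [map_smul_eq_mul, mul_comm]
          exact mul_le_mul_of_nonneg_left (norm_le_pi_norm v i) (apply_nonneg _ _)
      _ ≤ b * ‖v‖ := by
          rw [← Finset.sum_mul]
          refine mul_le_mul_of_nonneg_right ?_ (norm_nonneg _)
          simp [b]
  have hcont : Continuous N := by
    let b' : ℝ≥0 := ⟨b, hb0.le⟩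
    refine Seminorm.continuous_of_le (q := b' • normSeminorm ℝ (ι → ℝ)) ?_ fun v => ?_
    · exact (continuous_const.mul continuous_norm : Continuous fun v : ι → ℝ => b * ‖v‖)
    · exact hb v
  -- The sphere is empty only in dimension zero; otherwise the minimum of `N` on it is the lower
  -- constant.
  rcases (Metric.sphere (0 : ι → ℝ) 1).eq_empty_or_nonempty with hS | hS
  · refine ⟨1, b, one_pos, hb0, fun v => ⟨?_, hb v⟩⟩
    have hv : v = 0 := by
      by_contra hv
      have : ‖v‖⁻¹ • v ∈ Metric.sphere (0 : ι → ℝ) 1 := by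
        simp [norm_smul, inv_mul_cancel₀ (norm_ne_zero_iff.2 hv)]
      simp [hS] at this
    simp [hv]
  · obtain ⟨u, hu, hmin⟩ := (isCompact_sphere (0 : ι → ℝ) 1).exists_isMinOn hS hcont.continuousOn
    have hu0 : u ≠ 0 := fun h => by simp [h] at hu
    refine ⟨N u, b, lt_of_le_of_ne (apply_nonneg _ _) fun h => hu0 (hN u h.symm), hb0,
      fun v => ⟨?_, hb v⟩⟩
    by_cases hv : v = 0
    · simp [hv]
    have hv' : 0 < ‖v‖ := norm_pos_iff.2 hv
    have h1 : N u ≤ N (‖v‖⁻¹ • v) := hmin (by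
      simp [norm_smul, inv_mul_cancel₀ hv'.ne'])
    rw [map_smul_eq_mul, norm_inv, norm_norm, inv_mul_eq_div, le_div_iff₀ hv'] at h1
    exact h1

namespace ElectricNetwork

/-! ### Transience by averaging over dyadic cubes. -/

section Transience

variable {d : ℕ}

/-- The cube of side length `2 ^ k` with corner `x`. -/
noncomputable def dyadicCube (x : Fin d → ℤ) (k : ℕ) : Finset (Fin d → ℤ) :=
  Finset.Icc x fun i => x i + (2 ^ k - 1)

theorem card_dyadicCube (x : Fin d → ℤ) (k : ℕ) : (dyadicCube x k).card = (2 ^ k) ^ d := by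
  rw [dyadicCube, Pi.card_Icc]
  have : ∀ i, (x i + (2 ^ k - 1) + 1 - x i).toNat = 2 ^ k := fun i => by
    rw [show x i + (2 ^ k - 1) + 1 - x i = ((2 ^ k : ℕ) : ℤ) by push_cast; ring, Int.toNat_natCast]
  simp [this]

theorem dyadicCube_subset_succ (x : Fin d → ℤ) (k : ℕ) :
    dyadicCube x k ⊆ dyadicCube x (k + 1) :=
  Finset.Icc_subset_Icc_right fun i => by
    have : (0 : ℤ) < 2 ^ k := by positivity
    simp only [pow_succ]
    omega

theorem supNorm_sub_le_of_mem_dyadicCube {x y z : Fin d → ℤ} {k : ℕ} (hy : y ∈ dyadicCube x k)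
    (hz : z ∈ dyadicCube x k) : supNorm (y - z) ≤ 2 ^ k := by
  rw [dyadicCube, Finset.mem_Icc] at hy hz
  refine supNorm_le_iff.2 fun i => ?_
  have h1 := hy.1 i
  have h2 := hy.2 i
  have h3 := hz.1 i
  have h4 := hz.2 i
  rw [Pi.sub_apply]
  zify
  rw [abs_le]
  constructor <;> linarith

/-- The average of `f` over a dyadic cube. -/
noncomputable def cubeAvg (f : (Fin d → ℤ) → ℝ) (x : Fin d → ℤ) (k : ℕ) : ℝ :=
  (∑ y ∈ dyadicCube x k, f y) / (2 ^ k : ℝ) ^ d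

/-- The difference of averages is the mean of `f y - f z` over the product of the two cubes; apply
Cauchy–Schwarz and enlarge the smaller cube. -/
theorem sq_cubeAvg_sub_le (f : (Fin d → ℤ) → ℝ) (x : Fin d → ℤ) (k : ℕ) :
    (cubeAvg f x k - cubeAvg f x (k + 1)) ^ 2 ≤
      (∑ y ∈ dyadicCube x (k + 1), ∑ z ∈ dyadicCube x (k + 1), (f y - f z) ^ 2) /
        ((2 ^ k : ℝ) ^ d * (2 ^ (k + 1) : ℝ) ^ d) := by
  set a : ℝ := (2 ^ k : ℝ) ^ d with ha
  set b : ℝ := (2 ^ (k + 1) : ℝ) ^ d with hb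
  have hapos : 0 < a := by positivity
  have hbpos : 0 < b := by positivity
  have hca : ((dyadicCube x k).card : ℝ) = a := by rw [card_dyadicCube]; simp [ha]
  have hcb : ((dyadicCube x (k + 1)).card : ℝ) = b := by rw [card_dyadicCube]; simp [hb]
  have h1 : ∑ p ∈ dyadicCube x k ×ˢ dyadicCube x (k + 1), (f p.1 - f p.2) =
      a * b * (cubeAvg f x k - cubeAvg f x (k + 1)) := by
    rw [Finset.sum_product]
    simp only [Finset.sum_sub_distrib, Finset.sum_const, nsmul_eq_mul, hca, hcb, cubeAvg, ← ha,
      ← hb, ← Finset.mul_sum]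
    field_simp
  have h2 := sq_sum_le_card_mul_sum_sq (s := dyadicCube x k ×ˢ dyadicCube x (k + 1))
    (f := fun p => f p.1 - f p.2)
  rw [h1, Finset.card_product, Nat.cast_mul, hca, hcb, Finset.sum_product] at h2
  have h3 : ∑ y ∈ dyadicCube x k, ∑ z ∈ dyadicCube x (k + 1), (f y - f z) ^ 2 ≤
      ∑ y ∈ dyadicCube x (k + 1), ∑ z ∈ dyadicCube x (k + 1), (f y - f z) ^ 2 :=
    Finset.sum_le_sum_of_subset_of_nonneg (dyadicCube_subset_succ x k)
      fun y _ _ => Finset.sum_nonneg fun z _ => sq_nonneg _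
  rw [le_div_iff₀ (by positivity)]
  refine le_trans ?_ h3
  have h4 : a * b * ((cubeAvg f x k - cubeAvg f x (k + 1)) ^ 2 * (a * b)) ≤
      a * b * ∑ y ∈ dyadicCube x k, ∑ z ∈ dyadicCube x (k + 1), (f y - f z) ^ 2 := by
    refine le_trans (le_of_eq ?_) h2
    ring
  exact le_of_mul_le_mul_left h4 (by positivity)

theorem isTransient_of_le_cond (hd : 0 < d) (G : ElectricNetwork (Fin d → ℤ)) {c s : ℝ}
    (hc : 0 < c) (hs0 : 0 ≤ s) (hs : s < 2 * d)
    (h : ∀ x y : Fin d → ℤ, x ≠ y → c * (supNorm (x - y) : ℝ) ^ (-s) ≤ G.cond x y) :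
    G.IsTransient := by
  classical
  intro x
  set q : ℝ := 2 ^ ((s - 2 * d) / 2) with hq
  have hq0 : 0 < q := by positivity
  have hq1 : q < 1 := Real.rpow_lt_one_of_one_lt_of_neg one_lt_two (by linarith)
  set C : ℝ := 2 * 2 ^ (s - d) / c with hC
  have hC0 : 0 < C := by positivity
  refine G.returnProb_lt_one_of_energy (ε := ((1 - q) / 2) ^ 2 / C)
    (div_pos (pow_pos (by linarith) 2) hC0) fun B f hxB hfx hfB => ?_
  set E := G.energy B f with hE
  have hE0 : 0 ≤ E := G.energy_nonneg B f
  have hstep : ∀ k, |cubeAvg f x k - cubeAvg f x (k + 1)| ≤ √(C * E) * q ^ k := fun k => by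
    set Q := dyadicCube x (k + 1) with hQ
    -- The cube may stick out of `B`, so the energy is computed on the union.
    have hE' : G.energy (B ∪ Q) f = E := G.energy_eq_of_subset Finset.subset_union_left hfB
    have hcond : ∀ y ∈ Q, ∀ z ∈ Q, c * ((2 : ℝ) ^ (k + 1)) ^ (-s) * (f y - f z) ^ 2 ≤
        G.cond y z * (f y - f z) ^ 2 := fun y hy z hz => by
      by_cases hyz : y = z
      · simp [hyz]
      refine mul_le_mul_of_nonneg_right (le_trans ?_ (h y z hyz)) (sq_nonneg _)
      refine mul_le_mul_of_nonneg_left ?_ hc.le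
      refine Real.rpow_le_rpow_of_nonpos (by exact_mod_cast supNorm_sub_pos hyz) ?_ (by linarith)
      exact_mod_cast supNorm_sub_le_of_mem_dyadicCube hy hz
    have h1 : c * ((2 : ℝ) ^ (k + 1)) ^ (-s) * ∑ y ∈ Q, ∑ z ∈ Q, (f y - f z) ^ 2 ≤ 2 * E := by
      calc _ ≤ ∑ y ∈ Q, ∑ z ∈ Q, G.cond y z * (f y - f z) ^ 2 := by
            simp only [Finset.mul_sum]
            exact Finset.sum_le_sum fun y hy => Finset.sum_le_sum fun z hz => hcond y hy z hz
        _ ≤ ∑ y ∈ B ∪ Q, ∑ z ∈ B ∪ Q, G.cond y z * (f y - f z) ^ 2 := by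
            refine (Finset.sum_le_sum fun y _ => ?_).trans
              (Finset.sum_le_sum_of_subset_of_nonneg Finset.subset_union_right
                fun y _ _ => by positivity)
            exact Finset.sum_le_sum_of_subset_of_nonneg Finset.subset_union_right
              fun z _ _ => by positivity
        _ ≤ 2 * E := by linarith [G.energy_ge (B ∪ Q) f]
    rw [← sq_le_sq₀ (abs_nonneg _) (by positivity), sq_abs, mul_pow, Real.sq_sqrt (by positivity)]
    refine (sq_cubeAvg_sub_le f x k).trans ?_
    rw [div_le_iff₀ (by positivity), ← mul_le_mul_iff_right₀
      (show 0 < c * ((2 : ℝ) ^ (k + 1)) ^ (-s) by positivity)]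
    refine h1.trans (le_of_eq ?_)
    have e1 : (q ^ k) ^ 2 = 2 ^ ((s - 2 * d) * k) := by
      rw [hq, ← Real.rpow_natCast, ← Real.rpow_natCast, ← Real.rpow_mul two_pos.le,
        ← Real.rpow_mul two_pos.le]
      congr 1; push_cast; ring
    have e2 : ((2 : ℝ) ^ k) ^ d = 2 ^ ((k : ℝ) * d) := by
      rw [Real.rpow_mul two_pos.le, Real.rpow_natCast, Real.rpow_natCast]
    have e3 : ((2 : ℝ) ^ (k + 1)) ^ d = 2 ^ (((k : ℝ) + 1) * d) := by
      rw [Real.rpow_mul two_pos.le, Real.rpow_natCast]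
      norm_cast
    have e4 : ((2 : ℝ) ^ (k + 1)) ^ (-s) = 2 ^ (((k : ℝ) + 1) * (-s)) := by
      rw [Real.rpow_mul two_pos.le]
      norm_cast
    rw [e1, e2, e3, e4, hC]
    have e5 : (2 : ℝ) ^ (((k : ℝ) + 1) * (-s)) * 2 ^ (s - d) * 2 ^ ((s - 2 * d) * k) *
        2 ^ ((k : ℝ) * d) * 2 ^ (((k : ℝ) + 1) * d) = 1 := by
      simp only [← Real.rpow_add two_pos]
      rw [← Real.rpow_zero 2]
      congr 1; ring
    generalize (2 : ℝ) ^ (((k : ℝ) + 1) * (-s)) = a₁, (2 : ℝ) ^ (s - d) = a₂,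
      (2 : ℝ) ^ ((s - 2 * d) * k) = a₃, (2 : ℝ) ^ ((k : ℝ) * d) = a₄,
      (2 : ℝ) ^ (((k : ℝ) + 1) * d) = a₅ at e5 ⊢
    calc 2 * E = 2 * E * (a₁ * a₂ * a₃ * a₄ * a₅) := by rw [e5, mul_one]
      _ = c * a₁ * (2 * a₂ / c * E * a₃ * (a₄ * a₅)) := by field_simp
  have hsum : ∀ K, |cubeAvg f x 0| ≤ √(C * E) * ∑ k ∈ Finset.range K, q ^ k +
      |cubeAvg f x K| := fun K => by
    induction K with
    | zero => simp
    | succ K ih =>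
      rw [Finset.sum_range_succ]
      have h1 := hstep K
      have h2 := abs_sub_abs_le_abs_sub (cubeAvg f x K) (cubeAvg f x (K + 1))
      linarith
  have h0 : cubeAvg f x 0 = 1 := by simp [cubeAvg, dyadicCube, hfx]
  obtain ⟨K, hK⟩ : ∃ K, |cubeAvg f x K| ≤ 1 / 2 := by
    -- The sum of `f` over any cube is at most its `ℓ¹` norm, so a cube of volume over twice that
    -- norm suffices.
    obtain ⟨K, hK⟩ := pow_unbounded_of_one_lt (2 * ∑ y ∈ B, |f y|) (one_lt_two (α := ℝ))
    refine ⟨K, ?_⟩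
    have h1 : |∑ y ∈ dyadicCube x K, f y| ≤ ∑ y ∈ B, |f y| := by
      refine (Finset.abs_sum_le_sum_abs _ _).trans ?_
      rw [Finset.sum_subset (Finset.subset_union_right (s₁ := dyadicCube x K) (s₂ := B))
        fun y _ hy => by simp [hfB y hy]]
      exact Finset.sum_le_sum_of_subset_of_nonneg Finset.subset_union_left
        fun _ _ _ => abs_nonneg _
    have h2 : (2 : ℝ) ^ K ≤ (2 ^ K) ^ d := le_self_pow₀ (one_le_pow₀ one_le_two) hd.ne'
    rw [cubeAvg, abs_div, abs_of_pos (show (0 : ℝ) < (2 ^ K) ^ d by positivity),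
      div_le_iff₀ (by positivity)]
    linarith
  have hgeom : ∑ k ∈ Finset.range K, q ^ k ≤ 1 / (1 - q) := by
    rw [le_div_iff₀' (by linarith), mul_neg_geom_sum]
    linarith [pow_pos hq0 K]
  have hfin : 1 / 2 ≤ √(C * E) / (1 - q) := by
    have h1 := hsum K
    rw [h0, abs_one] at h1
    have h2 := mul_le_mul_of_nonneg_left hgeom (Real.sqrt_nonneg (C * E))
    rw [mul_one_div] at h2
    linarith
  rw [le_div_iff₀ (by linarith)] at hfin
  rw [div_le_iff₀ hC0, mul_comm E, ← Real.sq_sqrt (show 0 ≤ C * E by positivity)]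
  exact pow_le_pow_left₀ (by linarith) (by linarith) 2

end Transience

end ElectricNetwork

/-! ### Sums of powers, the Abel–Dini series and weighted Cauchy–Schwarz. -/

section Series

theorem sum_Ico_inv_two_sqrt_le {a b : ℕ} (hab : a ≤ b) :
    ∑ j ∈ Finset.Ico a b, 1 / (2 * √((j + 1 - a : ℕ) : ℝ)) ≤ √((b - a : ℕ) : ℝ) := by
  induction b, hab using Nat.le_induction with
  | base => simp
  | succ b hab ih =>
    rw [Finset.sum_Ico_succ_top hab]
    have h1 : ((b + 1 - a : ℕ) : ℝ) = ((b - a : ℕ) : ℝ) + 1 := by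
      rw [Nat.sub_add_comm hab]; push_cast; rfl
    rw [h1]
    set n : ℝ := ((b - a : ℕ) : ℝ)
    have hn : 0 ≤ n := Nat.cast_nonneg _
    have h2 := Real.sq_sqrt hn
    have h3 := Real.sq_sqrt (show 0 ≤ n + 1 by linarith)
    have h4 : 0 < √(n + 1) := Real.sqrt_pos.2 (by linarith)
    have h5 : 1 / (2 * √(n + 1)) ≤ √(n + 1) - √n := by
      rw [div_le_iff₀ (by positivity)]
      nlinarith [sq_nonneg (√(n + 1) - √n)]
    linarith

theorem sum_Ico_sqrt_div_sq_le {m : ℕ} (hm : 0 < m) (M : ℕ) :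
    ∑ r ∈ Finset.Ico m M, √(r : ℝ) / (r : ℝ) ^ 2 ≤ 4 / √(m : ℝ) := by
  rcases lt_or_ge M m with h | h
  · rw [Finset.Ico_eq_empty (by omega), Finset.sum_empty]; positivity
  -- The strengthened bound telescopes, which makes the induction work.
  suffices h' : ∑ r ∈ Finset.Ico m M, √(r : ℝ) / (r : ℝ) ^ 2 ≤ 4 / √(m : ℝ) - 4 / √(M : ℝ) from
    h'.trans (sub_le_self _ (by positivity))
  induction M, h using Nat.le_induction with
  | base => simp
  | succ M hM ih =>
    rw [Finset.sum_Ico_succ_top hM]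
    have hM1 : (1 : ℝ) ≤ M := by exact_mod_cast hm.trans_le hM
    suffices √(M : ℝ) / (M : ℝ) ^ 2 ≤ 4 / √(M : ℝ) - 4 / √((M + 1 : ℕ) : ℝ) by linarith
    push_cast
    have hs : 0 < √(M : ℝ) := Real.sqrt_pos.2 (by linarith)
    have ht : 0 < √((M : ℝ) + 1) := Real.sqrt_pos.2 (by linarith)
    have hs2 := Real.sq_sqrt (show (0 : ℝ) ≤ M by linarith)
    have ht2 := Real.sq_sqrt (show (0 : ℝ) ≤ M + 1 by linarith)
    set s := √(M : ℝ)
    set t := √((M : ℝ) + 1)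
    rw [← hs2] at ht2 hM1 ⊢
    have hts : t ≤ 3 / 2 * s := by
      refine le_of_sq_le_sq ?_ (by positivity)
      nlinarith
    have h1 : t * (s + t) ≤ 4 * s ^ 2 := by nlinarith
    have h2 : 4 / s - 4 / t = 4 / (s * (t * (s + t))) := by
      have : (t - s) * (s + t) = 1 := by linarith [ht2]
      field_simp
      linarith
    rw [h2, div_le_div_iff₀ (by positivity) (by positivity)]
    nlinarith [mul_le_mul_of_nonneg_left h1 (sq_nonneg s)]

/-- The real harmonic numbers. -/
noncomputable def harm (n : ℕ) : ℝ := ∑ i ∈ Finset.range n, 1 / ((i : ℝ) + 1)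

theorem harm_succ (n : ℕ) : harm (n + 1) = harm n + 1 / ((n : ℝ) + 1) := Finset.sum_range_succ _ _

theorem one_le_harm_succ (n : ℕ) : 1 ≤ harm (n + 1) := by
  induction n with
  | zero => simp [harm]
  | succ n ih =>
    rw [harm_succ]
    have : (0 : ℝ) ≤ 1 / (((n + 1 : ℕ) : ℝ) + 1) := by positivity
    linarith

/-- The terms of the Abel–Dini series of the harmonic series. -/
noncomputable def abelDini (j : ℕ) : ℝ := 1 / ((j + 1) * harm (j + 1))

/-- Each increment of `log H` is at most the relative increment of `H`, by `log t ≤ t - 1`. -/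
theorem log_harm_le_sum_abelDini (n : ℕ) :
    Real.log (harm (n + 1)) ≤ ∑ j ∈ Finset.range n, abelDini j := by
  induction n with
  | zero => simp [harm]
  | succ n ih =>
    rw [Finset.sum_range_succ]
    have h1 := one_le_harm_succ n
    have h2 := one_le_harm_succ (n + 1)
    have h3 : Real.log (harm (n + 1 + 1)) - Real.log (harm (n + 1)) ≤ abelDini n := by
      rw [← Real.log_div (by linarith) (by linarith)]
      refine (Real.log_le_sub_one_of_pos (by positivity)).trans ?_
      rw [harm_succ (n + 1), abelDini, add_div, div_self (by linarith), add_sub_cancel_left,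
        div_div]
      refine one_div_le_one_div_of_le (by positivity) ?_
      refine mul_le_mul_of_nonneg_right ?_ (by linarith)
      push_cast
      linarith
    linarith

theorem tendsto_sum_abelDini :
    Filter.Tendsto (fun n => ∑ j ∈ Finset.range n, abelDini j) Filter.atTop Filter.atTop := by
  refine Filter.tendsto_atTop_mono log_harm_le_sum_abelDini ?_
  exact Real.tendsto_log_atTop.comp
    ((Filter.tendsto_add_atTop_iff_nat 1).2 Real.tendsto_sum_range_one_div_nat_succ_atTop)

/-- A truncated partial sum. -/
noncomputable def truncSum (δ : ℕ → ℝ) (R a : ℕ) : ℝ := ∑ j ∈ Finset.range R with j < a, δ j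

theorem truncSum_of_le (δ : ℕ → ℝ) {R a : ℕ} (h : R ≤ a) :
    truncSum δ R a = ∑ j ∈ Finset.range R, δ j := by
  rw [truncSum, Finset.filter_true_of_mem fun j hj => (Finset.mem_range.1 hj).trans_le h]

/-- Cauchy–Schwarz with weights `2 * √(j + 1 - a)`, whose reciprocals sum to at most `√(b - a)`.
Equal weights would give the factor `b - a`, too large in dimension one, where `∑ r ^ (-2) * r`
diverges. -/
theorem sq_truncSum_sub_le (δ : ℕ → ℝ) (R : ℕ) {a b : ℕ} (hab : a ≤ b) :
    (truncSum δ R b - truncSum δ R a) ^ 2 ≤ ∑ j ∈ Finset.range R,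
      if a ≤ j ∧ j < b then 2 * √((j + 1 - a : ℕ) : ℝ) * δ j ^ 2 * √((b - a : ℕ) : ℝ) else 0 := by
  have h1 : truncSum δ R b - truncSum δ R a = ∑ j ∈ Finset.range R with a ≤ j ∧ j < b, δ j := by
    simp only [truncSum, Finset.sum_filter, ← Finset.sum_sub_distrib]
    refine Finset.sum_congr rfl fun j _ => ?_
    by_cases h1 : j < a
    · have : j < b := by omega
      simp [h1, this]
    · by_cases h2 : j < b
      · simp [h1, h2, not_lt.1 h1]
      · simp [h1, h2]
  have h2 : ∑ j ∈ Finset.range R with a ≤ j ∧ j < b, 1 / (2 * √((j + 1 - a : ℕ) : ℝ)) ≤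
      √((b - a : ℕ) : ℝ) := by
    refine le_trans (Finset.sum_le_sum_of_subset_of_nonneg (fun j hj => ?_)
      fun j _ _ => by positivity) (sum_Ico_inv_two_sqrt_le hab)
    rw [Finset.mem_filter] at hj
    exact Finset.mem_Ico.2 hj.2
  rw [h1, ← Finset.sum_filter, ← Finset.sum_mul]
  refine (Finset.sum_sq_le_sum_mul_sum_of_sq_le_mul _
    (f := fun j => 2 * √((j + 1 - a : ℕ) : ℝ) * δ j ^ 2)
    (g := fun j => 1 / (2 * √((j + 1 - a : ℕ) : ℝ))) (fun j _ => by positivity)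
    (fun j _ => by positivity) fun j hj => ?_).trans
    (mul_le_mul_of_nonneg_left h2 (Finset.sum_nonneg fun j _ => by positivity))
  have hj' := (Finset.mem_filter.1 hj).2
  have : 0 < √((j + 1 - a : ℕ) : ℝ) :=
    Real.sqrt_pos.2 (by exact_mod_cast (by omega : 0 < j + 1 - a))
  refine le_of_eq ?_
  field_simp

theorem sum_range_inv_sub (j : ℕ) :
    ∑ a ∈ Finset.range (j + 1), 1 / ((j + 1 - a : ℕ) : ℝ) = harm (j + 1) := by
  rw [harm, ← Finset.sum_range_reflect]
  refine Finset.sum_congr rfl fun a ha => ?_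
  have := Finset.mem_range.1 ha
  rw [← Nat.cast_succ]
  congr 2
  omega

end Series

/-! ### Counting lattice points on spheres of the supremum norm. -/

section Shells

/-- For `r ≥ 1` a full shell has `2` points if `d = 1` and `8 * r` if `d = 2`; `max r 1` accounts
for the centre. -/
theorem card_shell_le {d : ℕ} (hd : d = 1 ∨ d = 2) (S : Finset (Fin d → ℤ)) (y : Fin d → ℤ)
    (r : ℕ) : (S.filter fun z => supNorm (z - y) = r).card ≤ 8 * (max r 1) ^ (d - 1) := by
  classical
  have hinj : Function.Injective fun z : Fin d → ℤ => z - y := sub_left_injective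
  rcases Nat.eq_zero_or_pos r with rfl | hr
  · have h1 : ((S.filter fun z => supNorm (z - y) = 0).image fun z => z - y) ⊆
        latticeBox d 0 := fun z hz => by
      obtain ⟨w, hw, rfl⟩ := Finset.mem_image.1 hz
      exact mem_latticeBox.2 (Finset.mem_filter.1 hw).2.le
    have h2 := Finset.card_le_card h1
    rw [Finset.card_image_of_injective _ hinj, card_latticeBox] at h2
    refine h2.trans ?_
    simp
  · have h1 : ((S.filter fun z => supNorm (z - y) = r).image fun z => z - y) ⊆
        latticeBox d r \ latticeBox d (r - 1) := fun z hz => by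
      obtain ⟨w, hw, rfl⟩ := Finset.mem_image.1 hz
      have := (Finset.mem_filter.1 hw).2
      rw [Finset.mem_sdiff, mem_latticeBox, mem_latticeBox]
      omega
    have h2 := Finset.card_le_card h1
    have h3 : latticeBox d (r - 1) ⊆ latticeBox d r := fun z hz => by
      rw [mem_latticeBox] at hz ⊢
      omega
    rw [Finset.card_image_of_injective _ hinj, Finset.card_sdiff_of_subset h3, card_latticeBox,
      card_latticeBox] at h2
    refine h2.trans ?_
    obtain ⟨k, rfl⟩ : ∃ k, r = k + 1 := ⟨r - 1, by omega⟩
    rw [Nat.sub_le_iff_le_add, Nat.add_sub_cancel, max_eq_left (by omega)]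
    rcases hd with rfl | rfl
    · simp; omega
    · simp; nlinarith

theorem sum_comp_supNorm_le {d : ℕ} (hd : d = 1 ∨ d = 2) {S : Finset (Fin d → ℤ)}
    {y : Fin d → ℤ} {I : Finset ℕ} (hI : ∀ z ∈ S, supNorm (z - y) ∈ I) {h : ℕ → ℝ}
    (hh : ∀ r, 0 ≤ h r) :
    ∑ z ∈ S, h (supNorm (z - y)) ≤ ∑ r ∈ I, 8 * (max r 1 : ℝ) ^ (d - 1) * h r := by
  rw [← Finset.sum_fiberwise_of_maps_to hI]
  refine Finset.sum_le_sum fun r _ => ?_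
  rw [Finset.sum_congr rfl fun z hz => by rw [(Finset.mem_filter.1 hz).2], Finset.sum_const,
    nsmul_eq_mul]
  exact mul_le_mul_of_nonneg_right (by exact_mod_cast card_shell_le hd S y r) (hh r)

end Shells

namespace ElectricNetwork

/-! ### Recurrence by a radial test function. -/

section Recurrence

variable {d : ℕ}

theorem sum_cond_mul_sqrt_le (hd : d = 1 ∨ d = 2) (G : ElectricNetwork (Fin d → ℤ)) {A : ℝ}
    (hA : 0 ≤ A) (h : ∀ x y : Fin d → ℤ, x ≠ y → G.cond x y ≤ A / (supNorm (x - y) : ℝ) ^ (2 * d))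
    (y : Fin d → ℤ) {m : ℕ} (hm : 0 < m) (S : Finset (Fin d → ℤ))
    (hS : ∀ z ∈ S, m ≤ supNorm (z - y)) :
    ∑ z ∈ S, G.cond y z * √(supNorm (z - y) : ℝ) ≤
      32 * A / ((m : ℝ) ^ (d - 1) * √(m : ℝ)) := by
  have hI : ∀ z ∈ S, supNorm (z - y) ∈ Finset.Ico m ((S.sup fun z => supNorm (z - y)) + 1) :=
    fun z hz => Finset.mem_Ico.2 ⟨hS z hz, Nat.lt_succ_of_le
      (Finset.le_sup (f := fun z => supNorm (z - y)) hz)⟩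
  calc ∑ z ∈ S, G.cond y z * √(supNorm (z - y) : ℝ)
      ≤ ∑ z ∈ S, A / (supNorm (z - y) : ℝ) ^ (2 * d) * √(supNorm (z - y) : ℝ) := by
        refine Finset.sum_le_sum fun z hz => mul_le_mul_of_nonneg_right ?_ (Real.sqrt_nonneg _)
        rw [G.symm]
        refine h z y fun hzy => ?_
        have := hS z hz
        rw [hzy, sub_self, supNorm_eq_zero_iff.2 rfl] at this
        omega
    _ ≤ ∑ r ∈ Finset.Ico m ((S.sup fun z => supNorm (z - y)) + 1),
          8 * (max r 1 : ℝ) ^ (d - 1) * (A / (r : ℝ) ^ (2 * d) * √(r : ℝ)) :=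
        sum_comp_supNorm_le (h := fun r => A / (r : ℝ) ^ (2 * d) * √(r : ℝ)) hd hI
          fun r => by positivity
    _ ≤ ∑ r ∈ Finset.Ico m ((S.sup fun z => supNorm (z - y)) + 1),
          8 * A / (m : ℝ) ^ (d - 1) * (√(r : ℝ) / (r : ℝ) ^ 2) := by
        refine Finset.sum_le_sum fun r hr => ?_
        have hmr := (Finset.mem_Ico.1 hr).1
        have hr1 : (1 : ℝ) ≤ r := by exact_mod_cast hm.trans_le hmr
        have hmr' : (m : ℝ) ≤ r := by exact_mod_cast hmr
        have hm' : (0 : ℝ) < m := by exact_mod_cast hm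
        rw [max_eq_left hr1]
        calc 8 * (r : ℝ) ^ (d - 1) * (A / (r : ℝ) ^ (2 * d) * √(r : ℝ))
            = 8 * A / (r : ℝ) ^ (d - 1) * (√(r : ℝ) / (r : ℝ) ^ 2) := by
              rcases hd with rfl | rfl
              · norm_num; ring
              · norm_num; field_simp
          _ ≤ _ := by gcongr
    _ ≤ 8 * A / (m : ℝ) ^ (d - 1) * (4 / √(m : ℝ)) := by
        rw [← Finset.mul_sum]
        exact mul_le_mul_of_nonneg_left (sum_Ico_sqrt_div_sq_le hm _) (by positivity)
    _ = _ := by rw [div_mul_div_comm]; ring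

/-- The weighted conductance across level `j`. A point `y` at depth `m = j + 1 - supNorm (y - x)` is
at distance at least `m` from the far side, so it contributes `O(m ^ (1 - d))`; summing over shells
gives the harmonic factor. -/
theorem sum_sum_cond_mul_sqrt_le (hd : d = 1 ∨ d = 2) (G : ElectricNetwork (Fin d → ℤ)) {A : ℝ}
    (hA : 0 ≤ A) (h : ∀ x y : Fin d → ℤ, x ≠ y → G.cond x y ≤ A / (supNorm (x - y) : ℝ) ^ (2 * d))
    (x : Fin d → ℤ) (S : Finset (Fin d → ℤ)) (j : ℕ) :
    ∑ y ∈ S with supNorm (y - x) ≤ j, ∑ z ∈ S with j < supNorm (z - x),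
      G.cond y z * (2 * √((j + 1 - supNorm (y - x) : ℕ) : ℝ) *
        √((supNorm (z - x) - supNorm (y - x) : ℕ) : ℝ)) ≤
      512 * A * ((j + 1) * harm (j + 1)) := by
  have htri : ∀ y z : Fin d → ℤ, supNorm (z - x) - supNorm (y - x) ≤ supNorm (z - y) := by
    intro y z
    have := supNorm_le_add (y - x) (z - x)
    rw [sub_sub_sub_cancel_right, supNorm_sub_comm y z] at this
    omega
  calc _ ≤ ∑ y ∈ S with supNorm (y - x) ≤ j, 64 * A / ((j + 1 - supNorm (y - x) : ℕ) : ℝ) ^ (d - 1)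
          := by
        refine Finset.sum_le_sum fun y hy => ?_
        have hyj := (Finset.mem_filter.1 hy).2
        set m := j + 1 - supNorm (y - x) with hm
        have hm0 : 0 < m := by omega
        have hm' : (0 : ℝ) < m := by exact_mod_cast hm0
        have h1 := G.sum_cond_mul_sqrt_le hd hA h y hm0 (S.filter fun z => j < supNorm (z - x))
          fun z hz => by
            have h1 := (Finset.mem_filter.1 hz).2
            have h2 := htri y z
            omega
        calc _ ≤ ∑ z ∈ S with j < supNorm (z - x),
              2 * √(m : ℝ) * (G.cond y z * √(supNorm (z - y) : ℝ)) := by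
              refine Finset.sum_le_sum fun z _ => ?_
              have h3 : √((supNorm (z - x) - supNorm (y - x) : ℕ) : ℝ) ≤ √(supNorm (z - y) : ℝ) :=
                Real.sqrt_le_sqrt (by exact_mod_cast htri y z)
              calc _ ≤ (G.cond y z : ℝ) * (2 * √(m : ℝ) * √(supNorm (z - y) : ℝ)) := by gcongr
                _ = _ := by ring
          _ ≤ 2 * √(m : ℝ) * (32 * A / ((m : ℝ) ^ (d - 1) * √(m : ℝ))) := by
              rw [← Finset.mul_sum]
              exact mul_le_mul_of_nonneg_left h1 (by positivity)
          _ = _ := by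
              have : 0 < √(m : ℝ) := Real.sqrt_pos.2 hm'
              field_simp
              ring
    _ ≤ ∑ a ∈ Finset.range (j + 1), 8 * (max a 1 : ℝ) ^ (d - 1) *
          (64 * A / ((j + 1 - a : ℕ) : ℝ) ^ (d - 1)) :=
        sum_comp_supNorm_le (h := fun a => 64 * A / ((j + 1 - a : ℕ) : ℝ) ^ (d - 1)) hd
          (fun y hy => Finset.mem_range.2 (Nat.lt_succ_of_le (Finset.mem_filter.1 hy).2))
          fun a => by positivity
    _ ≤ ∑ a ∈ Finset.range (j + 1), 512 * A * (j + 1) * (1 / ((j + 1 - a : ℕ) : ℝ)) := by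
        refine Finset.sum_le_sum fun a ha => ?_
        have haj := Finset.mem_range.1 ha
        have hm1 : (0 : ℝ) < ((j + 1 - a : ℕ) : ℝ) := by
          exact_mod_cast (by omega : 0 < j + 1 - a)
        have hm2 : ((j + 1 - a : ℕ) : ℝ) ≤ j + 1 := by
          exact_mod_cast (by omega : j + 1 - a ≤ j + 1)
        have ha1 : (max a 1 : ℝ) ≤ j + 1 :=
          max_le (by exact_mod_cast haj.le) (by linarith [(Nat.cast_nonneg j : (0 : ℝ) ≤ j)])
        have key : (max a 1 : ℝ) ^ (d - 1) / ((j + 1 - a : ℕ) : ℝ) ^ (d - 1) ≤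
            (j + 1) / ((j + 1 - a : ℕ) : ℝ) := by
          rcases hd with rfl | rfl
          · simpa using (one_le_div hm1).2 hm2
          · simpa using div_le_div_of_nonneg_right ha1 hm1.le
        calc _ = 512 * A * ((max a 1 : ℝ) ^ (d - 1) / ((j + 1 - a : ℕ) : ℝ) ^ (d - 1)) := by ring
          _ ≤ 512 * A * ((j + 1) / ((j + 1 - a : ℕ) : ℝ)) := by gcongr
          _ = _ := by ring
    _ = _ := by rw [← Finset.mul_sum, sum_range_inv_sub]; ring

theorem sum_cond_mul_sq_truncSum_le (hd : d = 1 ∨ d = 2) (G : ElectricNetwork (Fin d → ℤ)) {A : ℝ}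
    (hA : 0 ≤ A) (h : ∀ x y : Fin d → ℤ, x ≠ y → G.cond x y ≤ A / (supNorm (x - y) : ℝ) ^ (2 * d))
    (x : Fin d → ℤ) (S : Finset (Fin d → ℤ)) (R : ℕ) :
    ∑ y ∈ S, ∑ z ∈ S, G.cond y z *
        (truncSum abelDini R (supNorm (z - x)) - truncSum abelDini R (supNorm (y - x))) ^ 2 ≤
      1024 * A * ∑ j ∈ Finset.range R, abelDini j := by
  set ρ : (Fin d → ℤ) → ℕ := fun y => supNorm (y - x) with hρ
  set F := truncSum abelDini R
  -- Each edge is oriented away from `x`; edges within a shell carry no energy.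
  set u : (Fin d → ℤ) → (Fin d → ℤ) → ℝ := fun y z =>
    if ρ y < ρ z then G.cond y z * (F (ρ z) - F (ρ y)) ^ 2 else 0 with hu
  have h1 : ∀ y z, G.cond y z * (F (ρ z) - F (ρ y)) ^ 2 = u y z + u z y := fun y z => by
    rcases lt_trichotomy (ρ y) (ρ z) with hlt | heq | hgt
    · simp [hu, hlt, hlt.not_gt]
    · simp [hu, heq]
    · simp only [hu, hgt, hgt.not_gt, if_true, if_false, zero_add]
      rw [G.symm]; ring
  have h2 : ∀ y z, u y z ≤ ∑ j ∈ Finset.range R, if ρ y ≤ j ∧ j < ρ z then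
      abelDini j ^ 2 * (G.cond y z * (2 * √((j + 1 - ρ y : ℕ) : ℝ) * √((ρ z - ρ y : ℕ) : ℝ)))
      else 0 := fun y z => by
    by_cases hlt : ρ y < ρ z
    · simp only [hu, hlt, if_true]
      refine (mul_le_mul_of_nonneg_left (sq_truncSum_sub_le abelDini R hlt.le)
        (NNReal.coe_nonneg _)).trans (le_of_eq ?_)
      rw [Finset.mul_sum]
      refine Finset.sum_congr rfl fun j _ => ?_
      split_ifs
      · ring
      · simp
    · simp only [hu, hlt, if_false]
      refine Finset.sum_nonneg fun j _ => ?_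
      split_ifs <;> positivity
  have h3 : ∑ y ∈ S, ∑ z ∈ S, u y z ≤ 512 * A * ∑ j ∈ Finset.range R, abelDini j := by
    calc ∑ y ∈ S, ∑ z ∈ S, u y z
        ≤ ∑ y ∈ S, ∑ z ∈ S, ∑ j ∈ Finset.range R, if ρ y ≤ j ∧ j < ρ z then
          abelDini j ^ 2 * (G.cond y z * (2 * √((j + 1 - ρ y : ℕ) : ℝ) * √((ρ z - ρ y : ℕ) : ℝ)))
          else 0 := Finset.sum_le_sum fun y _ => Finset.sum_le_sum fun z _ => h2 y z
      _ = ∑ j ∈ Finset.range R, abelDini j ^ 2 * ∑ y ∈ S with ρ y ≤ j, ∑ z ∈ S with j < ρ z,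
          G.cond y z * (2 * √((j + 1 - ρ y : ℕ) : ℝ) * √((ρ z - ρ y : ℕ) : ℝ)) := by
        rw [Finset.sum_congr rfl fun y _ => Finset.sum_comm, Finset.sum_comm]
        refine Finset.sum_congr rfl fun j _ => ?_
        rw [Finset.sum_filter, Finset.mul_sum]
        refine Finset.sum_congr rfl fun y _ => ?_
        by_cases hy : ρ y ≤ j
        · simp only [hy, true_and, if_true, Finset.sum_filter, Finset.mul_sum, mul_ite, mul_zero]
        · simp [hy]
      _ ≤ ∑ j ∈ Finset.range R, abelDini j ^ 2 * (512 * A * ((j + 1) * harm (j + 1))) :=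
        Finset.sum_le_sum fun j _ => mul_le_mul_of_nonneg_left
          (G.sum_sum_cond_mul_sqrt_le hd hA h x S j) (sq_nonneg _)
      _ = _ := by
        rw [Finset.mul_sum]
        refine Finset.sum_congr rfl fun j _ => ?_
        have := one_le_harm_succ j
        rw [abelDini]
        field_simp
  have h4 : ∑ y ∈ S, ∑ z ∈ S, u z y = ∑ y ∈ S, ∑ z ∈ S, u y z := Finset.sum_comm
  calc _ = ∑ y ∈ S, ∑ z ∈ S, (u y z + u z y) :=
        Finset.sum_congr rfl fun y _ => Finset.sum_congr rfl fun z _ => h1 y z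
    _ = 2 * ∑ y ∈ S, ∑ z ∈ S, u y z := by
        simp only [Finset.sum_add_distrib]
        rw [h4]; ring
    _ ≤ _ := by linarith

theorem isRecurrent_of_cond_le (hd : d = 1 ∨ d = 2) (G : ElectricNetwork (Fin d → ℤ)) {A : ℝ}
    (hA : 0 ≤ A)
    (h : ∀ x y : Fin d → ℤ, x ≠ y → G.cond x y ≤ A / (supNorm (x - y) : ℝ) ^ (2 * d)) :
    G.IsRecurrent := by
  classical
  intro x
  refine G.returnProb_eq_one_of_energy fun ε hε => ?_
  -- The energy will be at most `512 * A / L`; the extra `1` keeps `L` positive when `A = 0`.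
  obtain ⟨R, hR⟩ := (tendsto_sum_abelDini.eventually_ge_atTop (512 * A / ε + 1)).exists
  set L := ∑ j ∈ Finset.range R, abelDini j with hL
  have hL1 : 1 ≤ L := le_trans (le_add_of_nonneg_left (by positivity)) hR
  have hLA : 512 * A ≤ ε * L := by
    rw [← div_le_iff₀' hε]; linarith
  let B : Finset (Fin d → ℤ) := (latticeBox d R).image fun z => z + x
  have hB : ∀ y ∉ B, R ≤ supNorm (y - x) := fun y hy => by
    by_contra hlt
    exact hy (Finset.mem_image.2 ⟨y - x, mem_latticeBox.2 (not_le.1 hlt).le, by simp⟩)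
  refine ⟨B, fun y => 1 - truncSum abelDini R (supNorm (y - x)) / L, ?_, ?_, ?_⟩
  · exact Finset.mem_image.2 ⟨0, mem_latticeBox.2 (by rw [supNorm_eq_zero_iff.2 rfl]; omega),
      by simp⟩
  · simp [supNorm_eq_zero_iff.2, truncSum]
  · refine G.energy_le_of_forall (fun y hy => ?_) fun S _ => ?_
    · rw [truncSum_of_le _ (hB y hy), ← hL, div_self (by linarith), sub_self]
    · have h1 := G.sum_cond_mul_sq_truncSum_le hd hA h x S R
      rw [← hL] at h1
      calc _ = (∑ y ∈ S, ∑ z ∈ S, G.cond y z * (truncSum abelDini R (supNorm (z - x)) -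
              truncSum abelDini R (supNorm (y - x))) ^ 2) / L ^ 2 := by
            simp only [Finset.sum_div]
            refine Finset.sum_congr rfl fun y _ => Finset.sum_congr rfl fun z _ => ?_
            field_simp
            ring
        _ ≤ 2 * ε := by
            rw [div_le_iff₀ (by positivity)]
            nlinarith

end Recurrence

end ElectricNetwork

theorem mainTheorem6 (d : ℕ) (hd : d = 1 ∨ d = 2)
    (N : Seminorm ℝ (Fin d → ℝ)) (hN : ∀ v, N v = 0 → v = 0)
    (G : ElectricNetwork (Fin d → ℤ)) :
    ((∃ C : ℝ, ∀ x y : Fin d → ℤ, x ≠ y →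
        (G.cond x y : ℝ) ≤ C * N (latticeDiff x y) ^ (-(2 * d : ℝ))) → G.IsRecurrent) ∧
    ((∃ c s : ℝ, 0 < c ∧ s < 2 * d ∧ ∀ x y : Fin d → ℤ, x ≠ y →
        c * N (latticeDiff x y) ^ (-s) ≤ (G.cond x y : ℝ)) → G.IsTransient) := by
  obtain ⟨a, b, ha, hb, hab⟩ := N.exists_norm_bounds hN
  have hd0 : 0 < d := by omega
  have hlow : ∀ x y : Fin d → ℤ, a * supNorm (x - y) ≤ N (latticeDiff x y) := fun x y => by
    rw [← norm_latticeDiff]; exact (hab _).1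
  have hupp : ∀ x y : Fin d → ℤ, N (latticeDiff x y) ≤ b * supNorm (x - y) := fun x y => by
    rw [← norm_latticeDiff]; exact (hab _).2
  constructor
  · rintro ⟨C, hC⟩
    refine G.isRecurrent_of_cond_le hd (A := |C| / a ^ (2 * d)) (by positivity) fun x y hxy => ?_
    have hr : (0 : ℝ) < supNorm (x - y) := by exact_mod_cast supNorm_sub_pos hxy
    calc (G.cond x y : ℝ) ≤ C * N (latticeDiff x y) ^ (-(2 * d : ℝ)) := hC x y hxy
      _ ≤ |C| * (a * supNorm (x - y)) ^ (-(2 * d : ℝ)) :=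
          mul_le_mul (le_abs_self C) (Real.rpow_le_rpow_of_nonpos (by positivity) (hlow x y)
            (by simp)) (Real.rpow_nonneg (apply_nonneg N _) _) (abs_nonneg C)
      _ = _ := by
          rw [Real.rpow_neg (by positivity), show (2 * d : ℝ) = ((2 * d : ℕ) : ℝ) by push_cast; rfl,
            Real.rpow_natCast, mul_pow]
          field_simp
  · rintro ⟨c, s, hc, hs, h⟩
    -- Distinct lattice points have `supNorm` distance at least `1`, so raising a negative exponent
    -- `s` to `0` only weakens the lower bound.
    have hs' : max s 0 < 2 * d := max_lt hs (by positivity)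
    obtain ⟨k, hk, hk'⟩ : ∃ k : ℝ, 0 < k ∧ ∀ x y : Fin d → ℤ, x ≠ y →
        k * (supNorm (x - y) : ℝ) ^ (-s) ≤ N (latticeDiff x y) ^ (-s) := by
      -- The sign of `s` decides which side of the norm comparison bounds the power from below.
      rcases le_total 0 s with h0 | h0
      · refine ⟨b ^ (-s), by positivity, fun x y hxy => ?_⟩
        have hr : (0 : ℝ) < supNorm (x - y) := by exact_mod_cast supNorm_sub_pos hxy
        rw [← Real.mul_rpow hb.le hr.le]
        exact Real.rpow_le_rpow_of_nonpos (lt_of_lt_of_le (by positivity) (hlow x y)) (hupp x y)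
          (by linarith)
      · refine ⟨a ^ (-s), by positivity, fun x y hxy => ?_⟩
        rw [← Real.mul_rpow ha.le (Nat.cast_nonneg _)]
        exact Real.rpow_le_rpow (by positivity) (hlow x y) (by linarith)
    refine G.isTransient_of_le_cond hd0 (mul_pos hc hk) (le_max_right s 0) hs' fun x y hxy => ?_
    have hr : (1 : ℝ) ≤ supNorm (x - y) := by exact_mod_cast supNorm_sub_pos hxy
    calc c * k * (supNorm (x - y) : ℝ) ^ (-max s 0)
        ≤ c * k * (supNorm (x - y) : ℝ) ^ (-s) := by
          gcongr
          exact le_max_left s 0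
      _ = c * (k * (supNorm (x - y) : ℝ) ^ (-s)) := mul_assoc _ _ _
      _ ≤ c * N (latticeDiff x y) ^ (-s) := mul_le_mul_of_nonneg_left (hk' x y hxy) hc.le
      _ ≤ _ := h x y hxy
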